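/- Let $(M,g)$ be a smooth connected semi-Riemannian manifold of dimension $n\ge 3$ with Riemann–Christoffel curvature tensor $R$, where $R(X,Y)Z=\nabla_X\nabla_YZ-\nabla_Y\nabla_XZ-\nabla_{[X,Y]}Z$ and $R(X_1,X_2,X_3,X_4)=g(R(X_1,X_2)X_3,X_4)$, with Ricci tensor $S(X,Y)=\operatorname{tr}(Z\mapsto R(Z,X)Y)$ and scalar curvature $\kappa=\operatorname{tr}_g S$. For $(0,2)$-tensors $A,E$ put $$(A\wedge E)(X_1,X_2,Y_1,Y_2)=A(X_1,Y_2)E(X_2,Y_1)+A(X_2,Y_1)E(X_1,Y_2)-A(X_1,Y_1)E(X_2,Y_2)-A(X_2,Y_2)E(X_1,Y_1),$$ and let $$C=R-\frac{1}{n-2}\,g\wedge S+\frac{\kappa}{2(n-1)(n-2)}\,g\wedge g$$ be the Weyl conformal curvature tensor, with $C(X,Y)Z$ given by $g(C(X,Y)Z,W)=C(X,Y,Z,W)$. For a $(0,k)$-tensor $T$, a tensor $D\in\{R,C\}$ and a $(0,2)$-tensor $A$ put $$(D\cdot T)(X_1,\dots,X_k;X,Y)=-\sum_{i=1}^k T(X_1,\dots,D(X,Y)X_i,\dots,X_k),$$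 $$Q(A,T)(X_1,\dots,X_k;X,Y)=-\sum_{i=1}^k T(X_1,\dots,(X\wedge_A Y)X_i,\dots,X_k),\qquad (X\wedge_A Y)Z=A(Y,Z)X-A(X,Z)Y.$$ Suppose that 1. $(M,g)$ is Ricci semisymmetric: $R\cdot S=0$ on $M$; 2. $R\cdot R=Q(S,R)$ on $M$; 3. $(M,g)$ has pseudosymmetric Weyl tensor: there is a real function $L$ with $C\cdot C=L\,Q(g,C)$ at every point of $\{x\in M: C\ne 0 \text{ at } x\}$. Then $(M,g)$ is semisymmetric on $U_S=\{x\in M: S-\frac{\kappa}{n}g\neq 0\text{ at }x\}$, that is, $R\cdot R=0$ at every point of $U_S$. -/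

import Mathlib

set_option maxSynthPendingDepth 3

open scoped Manifold ContDiff

noncomputable section

/-! ## Tensor algebra on a real vector space

A `(0,k)`-tensor is written as a function `T : (Fin k → V) → ℝ` (for `k = 2` also as `A : V → V → ℝ`),
so that `T ![X₁, …, X_k]` is its value on `X₁, …, X_k`; a `(1,3)`-tensor is written as
`D : V → V → V → V`, with `D X Y` being the endomorphism `𝒟(X,Y)`. -/

namespace TensorAlg

variable {V : Type*} [AddCommGroup V] [Module ℝ V] {k : ℕ}

/-- A bilinear function as a `(0,2)`-tensor in uncurried form. -/
def two (A : V → V → ℝ) : (Fin 2 → V) → ℝ := fun v => A (v 0) (v 1)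

/-- The action of an endomorphism on a `(0,k)`-tensor:
`(H T)(X₁,…,X_k) = -T(H X₁,…,X_k) - ⋯ - T(X₁,…,H X_k)`. -/
def act (H : V → V) (T : (Fin k → V) → ℝ) : (Fin k → V) → ℝ :=
  fun v => - ∑ i, T (Function.update v i (H (v i)))

/-- The `(0,k+2)`-tensor `D · T`: `(D · T)(X₁,…,X_k; X, Y) = (𝒟(X,Y) · T)(X₁,…,X_k)`. -/
def dot (D : V → V → V → V) (T : (Fin k → V) → ℝ) : (Fin k → V) → V → V → ℝ :=
  fun v X Y => act (D X Y) T v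

/-- The endomorphism `X ∧_A Y : Z ↦ A(Y,Z) X - A(X,Z) Y`. -/
def wedgeEnd (A : V → V → ℝ) (X Y : V) : V → V := fun Z => A Y Z • X - A X Z • Y

/-- The Tachibana tensor `Q(A,T)(X₁,…,X_k; X, Y) = ((X ∧_A Y) · T)(X₁,…,X_k)`. -/
def tachibana (A : V → V → ℝ) (T : (Fin k → V) → ℝ) : (Fin k → V) → V → V → ℝ :=
  dot (wedgeEnd A) T

/-- The Kulkarni–Nomizu product of two `(0,2)`-tensors. -/
def kulkarniNomizu (A B : V → V → ℝ) : (Fin 4 → V) → ℝ := fun v =>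
  A (v 0) (v 3) * B (v 1) (v 2) + A (v 1) (v 2) * B (v 0) (v 3)
    - A (v 0) (v 2) * B (v 1) (v 3) - A (v 1) (v 3) * B (v 0) (v 2)

end TensorAlg

/-! ## Levi-Civita connection and curvature of a metric given in one chart

`G : E → (E →L[ℝ] E →L[ℝ] ℝ)` is a field of symmetric bilinear forms on a normed space, invertible
near the points of interest; `G y u v` is `g(∂_u, ∂_v)` at the point with coordinates `y`. -/

namespace ChartMetric

variable {E : Type*} [NormedAddCommGroup E] [NormedSpace ℝ E]

/-- The Christoffel symbols of the first kind (see `lowerChristoffel_apply`). -/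
def lowerChristoffel (G : E → E →L[ℝ] E →L[ℝ] ℝ) (y : E) : E →L[ℝ] E →L[ℝ] E →L[ℝ] ℝ :=
  let D : E →L[ℝ] E →L[ℝ] E →L[ℝ] ℝ := fderiv ℝ G y
  let F : (E →L[ℝ] E →L[ℝ] ℝ) →L[ℝ] (E →L[ℝ] E →L[ℝ] ℝ) :=
    (ContinuousLinearMap.flipₗᵢ ℝ E E ℝ).toContinuousLinearEquiv
  (1 / 2 : ℝ) • (D + D.flip - F ∘L D.flip)

theorem lowerChristoffel_apply (G : E → E →L[ℝ] E →L[ℝ] ℝ) (y u v w : E) :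
    lowerChristoffel G y u v w =
      (1 / 2) * (fderiv ℝ G y u v w + fderiv ℝ G y v u w - fderiv ℝ G y w u v) := by
  simp [lowerChristoffel]

/-- The Christoffel symbols of the second kind: `christoffel G y u v` is `∇_{∂_u} ∂_v` at `y`. -/
def christoffel (G : E → E →L[ℝ] E →L[ℝ] ℝ) (y : E) : E →L[ℝ] E →L[ℝ] E :=
  (ContinuousLinearMap.compL ℝ E (E →L[ℝ] ℝ) E (G y).inverse) ∘L lowerChristoffel G y

theorem christoffel_apply (G : E → E →L[ℝ] E →L[ℝ] ℝ) (y u v : E) :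
    christoffel G y u v = (G y).inverse (lowerChristoffel G y u v) := rfl

/-- The defining relation `g(∇_{∂_u} ∂_v, ∂_w) = ½ (∂_u g_{vw} + ∂_v g_{uw} - ∂_w g_{uv})`. -/
theorem apply_christoffel (G : E → E →L[ℝ] E →L[ℝ] ℝ) (y : E) (hy : (G y).IsInvertible)
    (u v w : E) : G y (christoffel G y u v) w =
      (1 / 2) * (fderiv ℝ G y u v w + fderiv ℝ G y v u w - fderiv ℝ G y w u v) := by
  rw [christoffel_apply, hy.self_apply_inverse, lowerChristoffel_apply]

/-- The `(1,3)` curvature tensor `R(u,v)w = ∇_u ∇_v w - ∇_v ∇_u w - ∇_{[u,v]} w` in the chart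
(see `curvature_apply`). -/
def curvature (G : E → E →L[ℝ] E →L[ℝ] ℝ) (y : E) : E →L[ℝ] E →L[ℝ] E →L[ℝ] E :=
  fderiv ℝ (christoffel G) y - (fderiv ℝ (christoffel G) y).flip
    + (ContinuousLinearMap.compL ℝ E E E).bilinearComp (christoffel G y) (christoffel G y)
    - ((ContinuousLinearMap.compL ℝ E E E).bilinearComp (christoffel G y) (christoffel G y)).flip

theorem curvature_apply (G : E → E →L[ℝ] E →L[ℝ] ℝ) (y u v w : E) :
    curvature G y u v w =
      fderiv ℝ (christoffel G) y u v w - fderiv ℝ (christoffel G) y v u w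
        + christoffel G y u (christoffel G y v w) - christoffel G y v (christoffel G y u w) := by
  simp [curvature]

/-- The Ricci contraction `(X,Y) ↦ trace (Z ↦ R(Z,X)Y)` of a `(1,3)`-tensor (see
`ricciOf_apply`). -/
def ricciOf (R : E →L[ℝ] E →L[ℝ] E →L[ℝ] E) : E →ₗ[ℝ] E →ₗ[ℝ] ℝ :=
  LinearMap.mk₂ ℝ (fun X Y => LinearMap.trace ℝ E ((R.flip X).flip Y).toLinearMap)
    (fun X X' Y => by rw [← map_add]; congr 1; ext Z; simp)
    (fun c X Y => by rw [← map_smul]; congr 1; ext Z; simp)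
    (fun X Y Y' => by rw [← map_add]; congr 1; ext Z; simp)
    (fun c X Y => by rw [← map_smul]; congr 1; ext Z; simp)

theorem ricciOf_apply (R : E →L[ℝ] E →L[ℝ] E →L[ℝ] E) (X Y : E) :
    ricciOf R X Y = LinearMap.trace ℝ E
      { toFun := fun Z => R Z X Y
        map_add' := fun Z Z' => by simp
        map_smul' := fun c Z => by simp } := rfl

end ChartMetric

/-! ## Semi-Riemannian manifolds -/

/-- A smooth semi-Riemannian metric: a smooth field of symmetric nondegenerate bilinear forms on the
tangent spaces of a manifold of dimension `n`. -/
structure SemiRiemannianMetric (n : ℕ) (M : Type*) [TopologicalSpace M]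
    [ChartedSpace (EuclideanSpace ℝ (Fin n)) M] [IsManifold (𝓡 n) ∞ M] where
  val (x : M) : TangentSpace (𝓡 n) x →L[ℝ] TangentSpace (𝓡 n) x →L[ℝ] ℝ
  symm (x : M) (v w : TangentSpace (𝓡 n) x) : val x v w = val x w v
  nondegenerate (x : M) (v : TangentSpace (𝓡 n) x) (hv : ∀ w, val x v w = 0) : v = 0
  contMDiff : ContMDiff (𝓡 n)
    ((𝓡 n).prod 𝓘(ℝ, EuclideanSpace ℝ (Fin n) →L[ℝ] EuclideanSpace ℝ (Fin n) →L[ℝ] ℝ)) ∞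
    (fun x => Bundle.TotalSpace.mk'
      (EuclideanSpace ℝ (Fin n) →L[ℝ] EuclideanSpace ℝ (Fin n) →L[ℝ] ℝ)
      (E := fun x : M => TangentSpace (𝓡 n) x →L[ℝ] TangentSpace (𝓡 n) x →L[ℝ] ℝ) x (val x))

namespace SemiRiemannianMetric

open TensorAlg

variable {n : ℕ} {M : Type*} [TopologicalSpace M]
  [ChartedSpace (EuclideanSpace ℝ (Fin n)) M] [IsManifold (𝓡 n) ∞ M]
  (g : SemiRiemannianMetric n M)

instance (x : M) : FiniteDimensional ℝ (TangentSpace (𝓡 n) x) :=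
  inferInstanceAs (FiniteDimensional ℝ (EuclideanSpace ℝ (Fin n)))

instance (x : M) : T2Space (TangentSpace (𝓡 n) x) :=
  inferInstanceAs (T2Space (EuclideanSpace ℝ (Fin n)))

/-- The metric in the preferred chart at `x`: the pull-back of `g` by the inverse of the chart. -/
def inChart (x : M) (y : EuclideanSpace ℝ (Fin n)) :
    EuclideanSpace ℝ (Fin n) →L[ℝ] EuclideanSpace ℝ (Fin n) →L[ℝ] ℝ :=
  let A : EuclideanSpace ℝ (Fin n) →L[ℝ] EuclideanSpace ℝ (Fin n) :=
    mfderiv 𝓘(ℝ, EuclideanSpace ℝ (Fin n)) (𝓡 n) (extChartAt (𝓡 n) x).symm y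
  let B : EuclideanSpace ℝ (Fin n) →L[ℝ] EuclideanSpace ℝ (Fin n) →L[ℝ] ℝ :=
    g.val ((extChartAt (𝓡 n) x).symm y)
  B.bilinearComp A A

theorem inChart_apply (x : M) (y u v : EuclideanSpace ℝ (Fin n)) :
    g.inChart x y u v = g.val ((extChartAt (𝓡 n) x).symm y)
      (mfderiv 𝓘(ℝ, EuclideanSpace ℝ (Fin n)) (𝓡 n) (extChartAt (𝓡 n) x).symm y u)
      (mfderiv 𝓘(ℝ, EuclideanSpace ℝ (Fin n)) (𝓡 n) (extChartAt (𝓡 n) x).symm y v) := rfl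

/-- The `(1,3)` Riemann–Christoffel curvature tensor at `x`, `R(X,Y)Z`, computed in the preferred
chart at `x` (whose differential at `x` is the identification of the tangent space at `x` with the
model space that Mathlib uses). -/
def curv (x : M) : TangentSpace (𝓡 n) x →L[ℝ] TangentSpace (𝓡 n) x →L[ℝ]
    TangentSpace (𝓡 n) x →L[ℝ] TangentSpace (𝓡 n) x :=
  ChartMetric.curvature (g.inChart x) (extChartAt (𝓡 n) x x)

/-- The `(1,3)` curvature tensor as a plain function. -/
def R13 (x : M) (X Y Z : TangentSpace (𝓡 n) x) : TangentSpace (𝓡 n) x := g.curv x X Y Z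

/-- The `(0,4)` curvature tensor `R(X₁,X₂,X₃,X₄) = g(R(X₁,X₂)X₃, X₄)`. -/
def R (x : M) : (Fin 4 → TangentSpace (𝓡 n) x) → ℝ :=
  fun v => g.val x (g.R13 x (v 0) (v 1) (v 2)) (v 3)

/-- The Ricci tensor `S(X,Y) = trace (Z ↦ R(Z,X)Y)`, as a bilinear map. -/
def ricci (x : M) : TangentSpace (𝓡 n) x →ₗ[ℝ] TangentSpace (𝓡 n) x →ₗ[ℝ] ℝ :=
  ChartMetric.ricciOf (ChartMetric.curvature (g.inChart x) (extChartAt (𝓡 n) x x))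

theorem ricci_apply (x : M) (X Y : TangentSpace (𝓡 n) x) :
    g.ricci x X Y = LinearMap.trace ℝ (TangentSpace (𝓡 n) x)
      { toFun := fun Z => g.R13 x Z X Y
        map_add' := fun Z Z' => by simp [R13]
        map_smul' := fun c Z => by simp [R13] } := rfl

/-- The metric at `x` as a plain function of two tangent vectors. -/
def g2 (x : M) : TangentSpace (𝓡 n) x → TangentSpace (𝓡 n) x → ℝ := fun X Y => g.val x X Y

/-- The Ricci tensor at `x` as a plain function of two tangent vectors. -/
def S (x : M) : TangentSpace (𝓡 n) x → TangentSpace (𝓡 n) x → ℝ := fun X Y => g.ricci x X Y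

/-- The Ricci operator `𝒮`, with `g(𝒮 X, Y) = S(X,Y)` (see `val_ricciOp`). -/
def ricciOp (x : M) : TangentSpace (𝓡 n) x →ₗ[ℝ] TangentSpace (𝓡 n) x :=
  (g.val x).inverse.toLinearMap ∘ₗ
    (LinearMap.toContinuousLinearMap :
      (TangentSpace (𝓡 n) x →ₗ[ℝ] ℝ) ≃ₗ[ℝ] (TangentSpace (𝓡 n) x →L[ℝ] ℝ)).toLinearMap ∘ₗ
    g.ricci x

theorem val_isInvertible (x : M) : (g.val x).IsInvertible := by
  have hinj : Function.Injective (g.val x).toLinearMap := by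
    rw [← LinearMap.ker_eq_bot, LinearMap.ker_eq_bot']
    intro v hv
    exact g.nondegenerate x v fun w => DFunLike.congr_fun hv w
  have hdim : Module.finrank ℝ (TangentSpace (𝓡 n) x) =
      Module.finrank ℝ (TangentSpace (𝓡 n) x →L[ℝ] ℝ) := by
    rw [← LinearEquiv.finrank_eq (LinearMap.toContinuousLinearMap :
      (TangentSpace (𝓡 n) x →ₗ[ℝ] ℝ) ≃ₗ[ℝ] (TangentSpace (𝓡 n) x →L[ℝ] ℝ))]
    exact (Subspace.dual_finrank_eq (K := ℝ) (V := TangentSpace (𝓡 n) x)).symm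
  refine ⟨(LinearEquiv.ofInjectiveOfFinrankEq _ hinj hdim).toContinuousLinearEquiv, ?_⟩
  ext v w
  rfl

theorem val_ricciOp (x : M) (X Y : TangentSpace (𝓡 n) x) :
    g.val x (g.ricciOp x X) Y = g.S x X Y := by
  simp [ricciOp, S, (g.val_isInvertible x).self_apply_inverse]

/-- The scalar curvature. -/
def scal (x : M) : ℝ := LinearMap.trace ℝ (TangentSpace (𝓡 n) x) (g.ricciOp x)

/-- The `(0,4)` Weyl conformal curvature tensor
`C = R - 1/(n-2) g ∧ S + κ/(2(n-1)(n-2)) g ∧ g`. -/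
def C (x : M) : (Fin 4 → TangentSpace (𝓡 n) x) → ℝ :=
  g.R x - (1 / ((n : ℝ) - 2)) • kulkarniNomizu (g.g2 x) (g.S x)
    + (g.scal x / (2 * ((n : ℝ) - 1) * ((n : ℝ) - 2))) • kulkarniNomizu (g.g2 x) (g.g2 x)

/-- The `(1,3)` Weyl conformal curvature tensor, `g(C(X₁,X₂)X₃, X₄) = C(X₁,X₂,X₃,X₄)`
(see `val_C13`). -/
def C13 (x : M) (X Y Z : TangentSpace (𝓡 n) x) : TangentSpace (𝓡 n) x :=
  g.R13 x X Y Z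
    - (1 / ((n : ℝ) - 2)) • (g.S x Y Z • X - g.S x X Z • Y
        + g.g2 x Y Z • g.ricciOp x X - g.g2 x X Z • g.ricciOp x Y)
    + (g.scal x / (((n : ℝ) - 1) * ((n : ℝ) - 2))) • (g.g2 x Y Z • X - g.g2 x X Z • Y)

theorem val_C13 (x : M) (X₁ X₂ X₃ X₄ : TangentSpace (𝓡 n) x) :
    g.val x (g.C13 x X₁ X₂ X₃) X₄ = g.C x ![X₁, X₂, X₃, X₄] := by
  have h : g.scal x / (2 * ((n : ℝ) - 1) * ((n : ℝ) - 2)) =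
      g.scal x / (((n : ℝ) - 1) * ((n : ℝ) - 2)) / 2 := by
    rw [div_div]; congr 1; ring
  simp [C13, C, R, kulkarniNomizu, val_ricciOp, g2, h]
  ring

/-- Ricci semisymmetry: `R · S = 0` on `M`. -/
def IsRicciSemisymmetric : Prop := ∀ x : M, dot (g.R13 x) (two (g.S x)) = 0

/-- Pseudosymmetric Weyl conformal curvature tensor: `C · C = L Q(g,C)` on `{x | C ≠ 0 at x}` for
some function `L`. -/
def HasPseudosymmetricWeyl : Prop :=
  ∃ L : M → ℝ, ∀ x : M, g.C x ≠ 0 → dot (g.C13 x) (g.C x) = L x • tachibana (g.g2 x) (g.C x)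

/-- The set `U_S` of points at which `S - (κ/n) g ≠ 0`. -/
def US : Set M := {x | g.S x - (g.scal x / (n : ℝ)) • g.g2 x ≠ 0}

end SemiRiemannianMetric

end

/-! The claim is pointwise linear algebra; smoothness only supplies the algebraic symmetries of `R`.
Since `R · R = Q(S,R)`, it suffices to show `Q(S,R) = 0` wherever `S` is not a multiple of `g`.

Let `op` be the Ricci operator. `R · S = 0` says that `op` commutes with every `R(x,y)`. Contracting
`R · R = Q(S,R)` then shows that `op` can be moved from any slot of `R` to any other (`op_first`,
`op_second`, `op_three`). Feeding `a` and `op a` back into `R · R = Q(S,R)` gives a scalar `t` with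
`op² = t op` and `R(op a, ·, ·, ·) = t R(a, ·, ·, ·)` (`exists_factor`). As `S` is not a multiple of
`g`, some `u ≠ 0` lies in the kernel of both `op` and `R` (`exists_kernel_vector`).

These relations give `C · C = (1 - α) Q(S,R) + (k - α t) Q(g,C)` with `α = 1/(n-2)` and `k =
κ/((n-1)(n-2))` (`weyl_dot_weyl`). For `n ≥ 4`, `α ≠ 1`, so `Q(S,R) = 0` at once if `C = 0` or `L =
k - α t`. Otherwise `Q(g,C)` is a multiple of `Q(S,R)`, hence vanishes when `u` is one of its last
two arguments; this determines `R` closely enough to compute `Q(S,R) = 0`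
(`tach_eq_zero_of_kernel_vector`). For `n = 3`, where `α = 1`, `R` lives on the plane `V/u` and
`Q(S,R) = 0` directly. -/

open Filter Topology Module

noncomputable section

/-! ### Symmetries of the curvature tensor in a chart. -/

namespace ChartMetric

variable {E : Type*} [NormedAddCommGroup E] [NormedSpace ℝ E]
  {G : E → E →L[ℝ] E →L[ℝ] ℝ} {p : E}

theorem curvature_antisymm (u v w : E) : curvature G p u v w = -curvature G p v u w := by
  simp only [curvature_apply]; abel

theorem fderiv_apply_comm (hs : ∀ y u v, G y u v = G y v u) (hG : DifferentiableAt ℝ G p)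
    (u v w : E) : fderiv ℝ G p u v w = fderiv ℝ G p u w v := by
  have e : ∀ v w, fderiv ℝ (fun y => G y v w) p u = fderiv ℝ G p u v w := fun v w => by
    have := ((hG.hasFDerivAt.clm_apply (hasFDerivAt_const v p)).clm_apply (hasFDerivAt_const w p))
    rw [this.fderiv]; simp
  rw [← e, ← e]
  simp only [hs _ v w]

section

variable [FiniteDimensional ℝ E]

theorem eventually_isInvertible (hG : ContinuousAt G p) (hp : (G p).IsInvertible) :
    ∀ᶠ y in 𝓝 p, (G y).IsInvertible := by
  obtain ⟨e, he⟩ := hp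
  exact hG.eventually (by rw [← he]; exact ContinuousLinearEquiv.nhds e)

omit [FiniteDimensional ℝ E] in
theorem differentiableAt_lowerChristoffel (hG : ContDiffAt ℝ 2 G p) :
    DifferentiableAt ℝ (lowerChristoffel G) p := by
  have h1 : DifferentiableAt ℝ (fderiv ℝ G) p :=
    (hG.fderiv_right (m := 1) (by norm_num)).differentiableAt (by norm_num)
  have h2 : DifferentiableAt ℝ (fun y => (fderiv ℝ G y).flip) p :=
    ((ContinuousLinearMap.flipₗᵢ ℝ E E
      (E →L[ℝ] ℝ)).toContinuousLinearEquiv.differentiableAt).comp p h1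
  exact ((h1.add h2).sub ((differentiableAt_const _).clm_comp h2)).const_smul (1 / 2 : ℝ)

theorem differentiableAt_christoffel (hG : ContDiffAt ℝ 2 G p) (hp : (G p).IsInvertible) :
    DifferentiableAt ℝ (christoffel G) p := by
  have : CompleteSpace E := FiniteDimensional.complete ℝ E
  have h2 : DifferentiableAt ℝ (fun y => (G y).inverse) p := by
    obtain ⟨e, he⟩ := hp
    have := (contDiffAt_map_inverse (𝕜 := ℝ) (n := 1) e)
    rw [he] at this
    exact (this.differentiableAt (by norm_num)).comp p (hG.differentiableAt (by norm_num))
  have h3 : DifferentiableAt ℝ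
      (fun y => ContinuousLinearMap.compL ℝ E (E →L[ℝ] ℝ) E (G y).inverse) p :=
    (ContinuousLinearMap.differentiableAt _).comp p h2
  exact h3.clm_comp (differentiableAt_lowerChristoffel hG)

omit [FiniteDimensional ℝ E] in
theorem christoffel_symm {y : E} (hs : ∀ y u v, G y u v = G y v u) (hG : DifferentiableAt ℝ G y)
    (u v : E) : christoffel G y u v = christoffel G y v u := by
  rw [christoffel_apply, christoffel_apply]
  congr 1
  ext w
  rw [lowerChristoffel_apply, lowerChristoffel_apply, fderiv_apply_comm hs hG w u v]
  ring

theorem fderiv_christoffel_symm (hs : ∀ y u v, G y u v = G y v u) (hG : ContDiffAt ℝ 2 G p)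
    (hp : (G p).IsInvertible) (u v w : E) :
    fderiv ℝ (christoffel G) p u v w = fderiv ℝ (christoffel G) p u w v := by
  have hΓ := differentiableAt_christoffel hG hp
  have e : ∀ v w, fderiv ℝ (fun y => christoffel G y v w) p u =
      fderiv ℝ (christoffel G) p u v w := fun v w => by
    have := ((hΓ.hasFDerivAt.clm_apply (hasFDerivAt_const v p)).clm_apply (hasFDerivAt_const w p))
    rw [this.fderiv]; simp
  rw [← e, ← e]
  have : (fun y => christoffel G y v w) =ᶠ[𝓝 p] fun y => christoffel G y w v := by
    filter_upwards [hG.eventually (by simp)] with y hy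
    exact christoffel_symm hs (hy.differentiableAt (by norm_num)) v w
  rw [this.fderiv_eq]

theorem curvature_bianchi (hs : ∀ y u v, G y u v = G y v u) (hG : ContDiffAt ℝ 2 G p)
    (hp : (G p).IsInvertible) (u v w : E) :
    curvature G p u v w + curvature G p v w u + curvature G p w u v = 0 := by
  have hc := christoffel_symm hs (hG.differentiableAt (by norm_num)) (y := p)
  have hf := fderiv_christoffel_symm hs hG hp
  simp only [curvature_apply]
  rw [hf u v w, hf v w u, hf w u v, hc v w, hc w u, hc u v]
  abel

omit [FiniteDimensional ℝ E] in
/-- The Levi-Civita connection is metric. -/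
theorem fderiv_eq_christoffel (hs : ∀ y u v, G y u v = G y v u) {y : E}
    (hG : DifferentiableAt ℝ G y) (hy : (G y).IsInvertible) (u v w : E) :
    fderiv ℝ G y u v w = G y (christoffel G y u v) w + G y v (christoffel G y u w) := by
  rw [hs y v, apply_christoffel G y hy, apply_christoffel G y hy,
    fderiv_apply_comm hs hG u w v, fderiv_apply_comm hs hG v u w, fderiv_apply_comm hs hG w u v]
  ring

/-- Differentiate the metric compatibility of the connection, which holds near `p`, once more and
antisymmetrise in `u, v`: the second derivatives of `G` cancel and the curvature terms remain. -/
theorem curvature_skew (hs : ∀ y u v, G y u v = G y v u) (hG : ContDiffAt ℝ 2 G p)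
    (hp : (G p).IsInvertible) (u v a b : E) :
    G p (curvature G p u v a) b = -G p (curvature G p u v b) a := by
  have hG1 := hG.differentiableAt (by norm_num)
  have hΓ := differentiableAt_christoffel hG hp
  have hD : DifferentiableAt ℝ (fderiv ℝ G) p :=
    (hG.fderiv_right (m := 1) (by norm_num)).differentiableAt (by norm_num)
  have hsym : ∀ u v, fderiv ℝ (fderiv ℝ G) p u v a b = fderiv ℝ (fderiv ℝ G) p v u a b :=
    fun u v => by
      rw [(hG.isSymmSndFDerivAt (by simp)).eq u v]
  have key : ∀ u v, fderiv ℝ (fderiv ℝ G) p u v a b =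
      fderiv ℝ G p u (christoffel G p v a) b + G p (fderiv ℝ (christoffel G) p u v a) b
      + fderiv ℝ G p u a (christoffel G p v b) + G p a (fderiv ℝ (christoffel G) p u v b) := by
    intro u v
    have hc := hasFDerivAt_const (𝕜 := ℝ) (E := E) (F := E) (x := p)
    have e1 := (((hD.hasFDerivAt.clm_apply (hc v)).clm_apply (hc a)).clm_apply (hc b)).fderiv
    have e2 := ((hG1.hasFDerivAt.clm_apply
      ((hΓ.hasFDerivAt.clm_apply (hc v)).clm_apply (hc a))).clm_apply (hc b)).add
      ((hG1.hasFDerivAt.clm_apply (hc a)).clm_apply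
        ((hΓ.hasFDerivAt.clm_apply (hc v)).clm_apply (hc b)))
    have e3 : (fun y => fderiv ℝ G y v a b) =ᶠ[𝓝 p] fun y => G y (christoffel G y v a) b
        + G y a (christoffel G y v b) := by
      filter_upwards [hG.eventually (by simp), eventually_isInvertible hG.continuousAt hp] with y hy hi
      exact fderiv_eq_christoffel hs (hy.differentiableAt (by norm_num)) hi v a b
    have e4 := (e1.symm.trans (e3.fderiv_eq.trans e2.fderiv))
    have := congrArg (fun N => N u) e4
    simp at this
    linarith
  have m := fderiv_eq_christoffel hs hG1 hp
  have k1 := key u v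
  have k2 := key v u
  rw [m, m] at k1 k2
  have := hsym u v
  simp only [curvature_apply, map_add, map_sub, add_apply, sub_apply]
  rw [hs p _ a, hs p _ a, hs p _ a, hs p _ a]
  linarith [hs p (christoffel G p u a) (christoffel G p v b)]

end

end ChartMetric

/-! ### Smoothness of the metric read in a chart. -/

theorem contDiffAt_clm_of_apply {D E F : Type*} [NormedAddCommGroup D] [NormedSpace ℝ D]
    [NormedAddCommGroup E] [NormedSpace ℝ E] [FiniteDimensional ℝ E]
    [NormedAddCommGroup F] [NormedSpace ℝ F] {n : WithTop ℕ∞} {f : D → E →L[ℝ] F} {p : D}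
    (h : ∀ y, ContDiffAt ℝ n (fun x => f x y) p) : ContDiffAt ℝ n f p := by
  let d := Module.finrank ℝ E
  have hd : d = Module.finrank ℝ (Fin d → ℝ) := (Module.finrank_fin_fun ℝ).symm
  let e₁ := ContinuousLinearEquiv.ofFinrankEq hd
  let e₂ := (e₁.arrowCongr (1 : F ≃L[ℝ] F)).trans (ContinuousLinearEquiv.piRing (Fin d))
  rw [← Function.id_comp f, ← e₂.symm_comp_self]
  exact e₂.symm.contDiff.contDiffAt.comp p (contDiffAt_pi.mpr fun i => h _)

namespace SemiRiemannianMetric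

variable {n : ℕ} {M : Type*} [TopologicalSpace M]
  [ChartedSpace (EuclideanSpace ℝ (Fin n)) M] [IsManifold (𝓡 n) ∞ M]
  (g : SemiRiemannianMetric n M)

theorem inChart_symm (x : M) (y u v : EuclideanSpace ℝ (Fin n)) :
    g.inChart x y u v = g.inChart x y v u := by
  rw [inChart_apply, inChart_apply, g.symm]

theorem mfderiv_extChartAt_symm_self (x : M) :
    mfderiv 𝓘(ℝ, EuclideanSpace ℝ (Fin n)) (𝓡 n) (extChartAt (𝓡 n) x).symm
      (extChartAt (𝓡 n) x x) = ContinuousLinearMap.id ℝ _ := by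
  have : IsManifold (𝓡 n) 1 M := IsManifold.of_le (n := ∞) (by norm_num)
  have := mfderivWithin_range_extChartAt_symm (I := 𝓡 n) (x := x)
  simpa using this

theorem inChart_self (x : M) : g.inChart x (extChartAt (𝓡 n) x x) = g.val x := by
  ext u v
  have h0 : (extChartAt (𝓡 n) x).symm (extChartAt (𝓡 n) x x) = x := extChartAt_to_inv x
  rw [inChart_apply, mfderiv_extChartAt_symm_self]
  have key : ∀ (m : M) (_ : m = x) (u v : EuclideanSpace ℝ (Fin n)),
      (g.val m : EuclideanSpace ℝ (Fin n) →L[ℝ] EuclideanSpace ℝ (Fin n) →L[ℝ] ℝ) u v =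
      (g.val x : EuclideanSpace ℝ (Fin n) →L[ℝ] EuclideanSpace ℝ (Fin n) →L[ℝ] ℝ) u v := by
    rintro _ rfl u v; rfl
  exact key _ h0 u v

theorem contMDiffAt_val_symmL (x : M) (u v : EuclideanSpace ℝ (Fin n)) :
    ContMDiffAt (𝓡 n) 𝓘(ℝ, ℝ) ∞ (fun m => g.val m
      ((trivializationAt (EuclideanSpace ℝ (Fin n)) (TangentSpace (𝓡 n)) x).symmL ℝ m u)
      ((trivializationAt (EuclideanSpace ℝ (Fin n)) (TangentSpace (𝓡 n)) x).symmL ℝ m v)) x := by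
  have hsec : ∀ u : EuclideanSpace ℝ (Fin n), ContMDiffAt (𝓡 n) (𝓡 n).tangent ∞
      (fun m => Bundle.TotalSpace.mk' (EuclideanSpace ℝ (Fin n)) (E := TangentSpace (𝓡 n)) m
        ((trivializationAt (EuclideanSpace ℝ (Fin n)) (TangentSpace (𝓡 n)) x).symmL ℝ m u)) x := by
    intro u
    have hc : ContMDiffAt (𝓡 n) ((𝓡 n).prod 𝓘(ℝ, EuclideanSpace ℝ (Fin n))) ∞
        (fun m : M => Bundle.TotalSpace.mk' (EuclideanSpace ℝ (Fin n))
          (E := Bundle.Trivial M (EuclideanSpace ℝ (Fin n))) m u) x := by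
      rw [Bundle.contMDiffAt_section]
      exact contMDiffAt_const
    exact ContMDiffAt.clm_bundle_apply
      ((trivializationAt (EuclideanSpace ℝ (Fin n)) (TangentSpace (𝓡 n)) x).contMDiffAt_symmL
        (FiberBundle.mem_baseSet_trivializationAt' x)) hc
  have : ContMDiffAt (𝓡 n) ((𝓡 n).prod 𝓘(ℝ, ℝ)) ∞
      (fun m => Bundle.TotalSpace.mk' ℝ (E := Bundle.Trivial M ℝ) m (g.val m
      ((trivializationAt (EuclideanSpace ℝ (Fin n)) (TangentSpace (𝓡 n)) x).symmL ℝ m u)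
      ((trivializationAt (EuclideanSpace ℝ (Fin n)) (TangentSpace (𝓡 n)) x).symmL ℝ m v))) x :=
    ContMDiffAt.clm_bundle_apply₂ (F₁ := EuclideanSpace ℝ (Fin n))
      (F₂ := EuclideanSpace ℝ (Fin n)) g.contMDiff.contMDiffAt (hsec u) (hsec v)
  simp only [Bundle.contMDiffAt_totalSpace] at this
  exact this.2

/-- Near `x`, the differential of the inverse chart is the inverse of the tangent bundle
trivialization at `x`, so smoothness of `g` as a bundle section applies. -/
theorem contDiffAt_inChart (x : M) : ContDiffAt ℝ ∞ (g.inChart x) (extChartAt (𝓡 n) x x) := by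
  have : IsManifold (𝓡 n) 1 M := IsManifold.of_le (n := ∞) (by norm_num)
  refine contDiffAt_clm_of_apply fun u => contDiffAt_clm_of_apply fun v => ?_
  have h1 : ContMDiffAt 𝓘(ℝ, EuclideanSpace ℝ (Fin n)) (𝓡 n) ∞ (extChartAt (𝓡 n) x).symm
      (extChartAt (𝓡 n) x x) :=
    (contMDiffOn_extChartAt_symm x).contMDiffAt (extChartAt_target_mem_nhds x)
  have h2 := (g.contMDiffAt_val_symmL x u v)
  have h3 := (h2.comp_of_eq h1 (extChartAt_to_inv x)).contDiffAt
  refine h3.congr_of_eventuallyEq ?_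
  filter_upwards [extChartAt_target_mem_nhds (I := 𝓡 n) x] with y hy
  have h4 := TangentBundle.symmL_trivializationAt (I := 𝓡 n) (x₀ := x)
    (x := (extChartAt (𝓡 n) x).symm y) (by
      rw [← extChartAt_source (𝓡 n)]; exact (extChartAt (𝓡 n) x).map_target hy)
  rw [(extChartAt (𝓡 n) x).right_inv hy] at h4
  simp only [modelWithCornersSelf_coe, Set.range_id, mfderivWithin_univ] at h4
  rw [inChart_apply]
  simp only [Function.comp_apply, h4]
  rfl

end SemiRiemannianMetric

/-! ### Algebraic curvature tensors and their contractions. -/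

namespace CurvatureLike

variable {V : Type*} [AddCommGroup V] [Module ℝ V]

/-- `Rm` is a `(1,3)`-tensor with the symmetries of a curvature tensor of the scalar product `g`. -/
structure IsCurvatureLike (g : V →ₗ[ℝ] V →ₗ[ℝ] ℝ) (Rm : V →ₗ[ℝ] V →ₗ[ℝ] V →ₗ[ℝ] V) : Prop where
  symm (a b : V) : g a b = g b a
  nondegenerate (a : V) (h : ∀ b, g a b = 0) : a = 0
  antisymm (a b c : V) : Rm a b c = -Rm b a c
  bianchi (a b c : V) : Rm a b c + Rm b c a + Rm c a b = 0
  skew (a b c d : V) : g (Rm a b c) d = -g (Rm a b d) c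

/-- The Ricci contraction `trace (Z ↦ Rm Z a b)`. -/
def ric (Rm : V →ₗ[ℝ] V →ₗ[ℝ] V →ₗ[ℝ] V) (a b : V) : ℝ :=
  LinearMap.trace ℝ V ((Rm.flip a).flip b)

variable {g : V →ₗ[ℝ] V →ₗ[ℝ] ℝ} {Rm : V →ₗ[ℝ] V →ₗ[ℝ] V →ₗ[ℝ] V}

theorem IsCurvatureLike.antisymm' (h : IsCurvatureLike g Rm) (a b c d : V) :
    g (Rm a b c) d = -g (Rm b a c) d := by
  rw [h.antisymm]; simp

theorem IsCurvatureLike.bianchi' (h : IsCurvatureLike g Rm) (a b c d : V) :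
    g (Rm a b c) d + g (Rm b c a) d + g (Rm c a b) d = 0 := by
  have := congrArg (fun z => g z d) (h.bianchi a b c)
  simpa using this

theorem IsCurvatureLike.pair (h : IsCurvatureLike g Rm) (a b c d : V) :
    g (Rm a b c) d = g (Rm c d a) b := by
  have A := h.antisymm'
  have B := h.bianchi'
  have S := h.skew
  linarith [B a b c d, B b c d a, B c d a b, B d a b c, A a b c d, A c d a b, S a b c d, S c d a b,
    S b c a d, S c a b d, S c d b a, S d b c a, S d a c b, S a c d b, S a b d c, S b d a c,
    A b d a c, A c a b d, A d a b c, A b c d a, S b c d a, S d a b c, A d a c b, A b c a d]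

theorem IsCurvatureLike.ext (h : IsCurvatureLike g Rm) {a b : V} (hab : ∀ c, g a c = g b c) :
    a = b := by
  refine sub_eq_zero.1 (h.nondegenerate _ fun c => ?_)
  simp [hab]

section Trace

variable [FiniteDimensional ℝ V]

/-- The trace as a contraction with the metric. -/
theorem IsCurvatureLike.exists_contraction (h : IsCurvatureLike g Rm) :
    ∃ (e e' : Fin (finrank ℝ V) → V),
      (∀ A : V →ₗ[ℝ] V, LinearMap.trace ℝ V A = ∑ i, g (A (e i)) (e' i)) ∧
      (∀ A : V →ₗ[ℝ] V, LinearMap.trace ℝ V A = ∑ i, g (A (e' i)) (e i)) := by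
  have hB : (LinearMap.BilinForm.Nondegenerate g) := by
    refine ⟨fun a ha => h.nondegenerate a ha, fun a ha => h.nondegenerate a fun b => ?_⟩
    rw [h.symm]; exact ha b
  let e := finBasis ℝ V
  let e' := LinearMap.BilinForm.dualBasis g hB e
  have key : ∀ i j, g (e' i) (e j) = if j = i then 1 else 0 :=
    fun i j => LinearMap.BilinForm.apply_dualBasis_left (B := g) hB e i j
  have tr : ∀ (b b' : Basis (Fin (finrank ℝ V)) ℝ V)
      (_ : ∀ i j, g (b' i) (b j) = if j = i then 1 else 0) (A : V →ₗ[ℝ] V),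
      LinearMap.trace ℝ V A = ∑ i, g (A (b i)) (b' i) := by
    intro b b' hb A
    rw [LinearMap.trace_eq_matrix_trace ℝ b, Matrix.trace]
    refine Finset.sum_congr rfl fun i _ => ?_
    rw [Matrix.diag_apply, LinearMap.toMatrix_apply, h.symm]
    have := congrArg (g (b' i)) (b.sum_repr (A (b i)))
    rw [← this, map_sum]
    simp [hb, -Basis.sum_repr]
  refine ⟨e, e', tr e e' key, tr e' e fun i j => ?_⟩
  rw [h.symm, key]; simp [eq_comm]

theorem IsCurvatureLike.ric_symm (h : IsCurvatureLike g Rm) (a b : V) : ric Rm a b = ric Rm b a := by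
  obtain ⟨e, e', h1, h2⟩ := h.exists_contraction
  rw [ric, ric, h1, h2]
  refine Finset.sum_congr rfl fun i _ => ?_
  simp only [LinearMap.flip_apply]
  rw [h.pair, h.antisymm', h.skew, neg_neg]

/-- Contraction of `H · R = K · R` over the first and the fourth argument, where `H'`, `K'` are the
adjoints of `H`, `K`. -/
theorem IsCurvatureLike.contraction (h : IsCurvatureLike g Rm) (H H' K K' : V →ₗ[ℝ] V)
    (hH : ∀ x y, g x (H y) = g (H' x) y) (hK : ∀ x y, g x (K y) = g (K' x) y)
    (hHK : ∀ a b c d, g (Rm (H a) b c) d + g (Rm a (H b) c) d + g (Rm a b (H c)) d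
      + g (Rm a b c) (H d) = g (Rm (K a) b c) d + g (Rm a (K b) c) d + g (Rm a b (K c)) d
      + g (Rm a b c) (K d)) (b c : V) :
    LinearMap.trace ℝ V (((Rm.flip b).flip c) ∘ₗ H) + ric Rm (H b) c + ric Rm b (H c) +
      LinearMap.trace ℝ V (H' ∘ₗ ((Rm.flip b).flip c)) =
    LinearMap.trace ℝ V (((Rm.flip b).flip c) ∘ₗ K) + ric Rm (K b) c + ric Rm b (K c) +
      LinearMap.trace ℝ V (K' ∘ₗ ((Rm.flip b).flip c)) := by
  obtain ⟨e, e', h1, -⟩ := h.exists_contraction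
  simp only [ric, h1, ← Finset.sum_add_distrib]
  refine Finset.sum_congr rfl fun i _ => ?_
  simpa [hH, hK] using hHK (e i) b c (e' i)

/-- The trace of an endomorphism of rank at most two. -/
theorem trace_smulRight_sub (φ ψ : V →ₗ[ℝ] ℝ) (x y : V) :
    LinearMap.trace ℝ V (φ.smulRight x - ψ.smulRight y) = φ x - ψ y := by
  simp

end Trace

end CurvatureLike

/-! ### Moving the Ricci operator between the slots of `R`. -/

namespace CurvatureLike

variable {V : Type*} [AddCommGroup V] [Module ℝ V]

variable {g : V →ₗ[ℝ] V →ₗ[ℝ] ℝ} {Rm : V →ₗ[ℝ] V →ₗ[ℝ] V →ₗ[ℝ] V} {op : V →ₗ[ℝ] V}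

/-- The conditions `R · S = 0` and `R · R = Q(S, R)`, where `S = g (op ·) ·` is the Ricci tensor
of `R`. -/
structure IsRicciPseudosymmetric (g : V →ₗ[ℝ] V →ₗ[ℝ] ℝ) (Rm : V →ₗ[ℝ] V →ₗ[ℝ] V →ₗ[ℝ] V)
    (op : V →ₗ[ℝ] V) : Prop extends IsCurvatureLike g Rm where
  ric_eq (a b : V) : g (op a) b = ric Rm a b
  dot_ric (a b x y : V) : g (op (Rm x y a)) b + g (op a) (Rm x y b) = 0
  dot_self (x y a b c d : V) :
    g (Rm (Rm x y a) b c) d + g (Rm a (Rm x y b) c) d + g (Rm a b (Rm x y c)) d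
      + g (Rm a b c) (Rm x y d) =
    g (Rm (g (op y) a • x - g (op x) a • y) b c) d
      + g (Rm a (g (op y) b • x - g (op x) b • y) c) d
      + g (Rm a b (g (op y) c • x - g (op x) c • y)) d
      + g (Rm a b c) (g (op y) d • x - g (op x) d • y)

namespace IsRicciPseudosymmetric

variable (h : IsRicciPseudosymmetric g Rm op)
include h

theorem op_comm (x y a : V) : op (Rm x y a) = Rm x y (op a) :=
  h.ext fun b => by linarith [h.dot_ric a b x y, h.skew x y (op a) b, h.symm (op a) (Rm x y b)]

variable [FiniteDimensional ℝ V]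

theorem op_symm (a b : V) : g (op a) b = g (op b) a := by
  rw [h.ric_eq, h.ric_eq, h.ric_symm]

theorem op_adj (a b : V) : g a (op b) = g (op a) b := by
  rw [h.symm, h.op_symm]

theorem op_three (a b c d : V) : g (Rm a b (op c)) d = g (Rm a b c) (op d) := by
  rw [h.op_adj, h.op_comm]

theorem op_contraction (b c x y : V) :
    g (Rm x b c) (op y) - g (Rm y b c) (op x) + g (Rm (op y) b c) x - g (Rm (op x) b c) y = 0 := by
  -- `Rm x y` is skew, so its two trace terms cancel, and `R · S = 0` removes its Ricci terms; only
  -- the contraction of `Q(S,R)` survives.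
  have key := h.contraction (Rm x y) (-(Rm x y))
    ((g (op y)).smulRight x - (g (op x)).smulRight y)
    ((g x).smulRight (op y) - (g y).smulRight (op x))
    (fun u v => by simp [h.skew x y u v, h.symm u])
    (fun u v => by simp [h.symm u x, h.symm u y]; ring)
    (fun a b c d => by simpa using h.dot_self x y a b c d) b c
  have e1 : (-(Rm x y)) ∘ₗ ((Rm.flip b).flip c) = -((Rm x y) ∘ₗ ((Rm.flip b).flip c)) := rfl
  have e2 : ((Rm.flip b).flip c) ∘ₗ ((g (op y)).smulRight x - (g (op x)).smulRight y) =
      (g (op y)).smulRight (Rm x b c) - (g (op x)).smulRight (Rm y b c) := by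
    ext z; simp
  have e3 : ((g x).smulRight (op y) - (g y).smulRight (op x)) ∘ₗ ((Rm.flip b).flip c) =
      ((g x) ∘ₗ ((Rm.flip b).flip c)).smulRight (op y)
        - ((g y) ∘ₗ ((Rm.flip b).flip c)).smulRight (op x) := by
    ext z; simp
  rw [e1, e2, e3, map_neg, LinearMap.trace_comp_comm', trace_smulRight_sub, trace_smulRight_sub]
    at key
  simp only [← h.ric_eq] at key
  simp only [LinearMap.sub_apply, LinearMap.smulRight_apply, LinearMap.comp_apply,
    LinearMap.flip_apply, map_sub, map_smul, LinearMap.smul_apply, smul_eq_mul] at key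
  linear_combination (-1 : ℝ) * key + h.dot_ric b c x y
    - h.symm (op y) (Rm x b c) + h.symm (op x) (Rm y b c)
    - h.symm x (Rm (op y) b c) + h.symm y (Rm (op x) b c)
    - g (op y) c * h.op_symm b x + g (op x) c * h.op_symm b y

/-- The tensor `F(a,b,c,d) = R(a,b,c,op d)` is skew in `a, b` and, by `op_three`, skew in `c, d`.
The contracted identity supplies just enough to make `F` symmetric under exchange of the two pairs,
which carries `op` from the second pair to the first. -/
theorem op_first (a b c d : V) : g (Rm (op a) b c) d = g (Rm a b (op c)) d := by
  have A := fun a b c d => h.antisymm' a b c (op d)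
  have B := fun a b c d => (h.op_three a b d c).symm.trans (h.skew a b (op d) c)
  have W : ∀ a b c d, g (Rm a b c) (op d) - g (Rm c d a) (op b) =
      g (Rm d b c) (op a) - g (Rm c a d) (op b) := fun a b c d => by
    linarith [h.op_contraction b c a d, h.pair (op d) b c a, h.pair (op a) b c d,
      h.op_three c a d b, h.op_three c d a b]
  have U : g (Rm a b c) (op d) = g (Rm c d a) (op b) := by
    linarith [W a b c d, W b d a c, A b d a c, B d b c a, A c a d b, B d b a c, B a c b d,
      A c d a b, B d c a b, A a b c d, A d b c a, A a c b d, B c a d b, A d b a c]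
  linarith [h.pair (op a) b c d, h.op_three c d a b, h.op_three a b c d]

theorem op_second (a b c d : V) : g (Rm a (op b) c) d = g (Rm a b (op c)) d := by
  rw [h.antisymm', h.op_first, h.antisymm' b, neg_neg]

theorem op_first_self (a y c d : V) :
    g (op a) a * g (Rm y (op a) c) d = g (op (op a)) a * g (Rm y a c) d := by
  have h1 := h.dot_self a y (op a) a c d
  have h2 := h.dot_self a y a (op a) c d
  have e : ∀ x c d, g (Rm x x c) d = 0 := fun x c d => by linarith [h.antisymm' x x c d]
  have e' : ∀ x c d, g (op (Rm x x c)) d = 0 := fun x c d => by rw [h.op_symm, h.symm, e]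
  have f : g (op (Rm a y c)) d = -g (op (Rm y a c)) d := by
    rw [h.antisymm]; simp
  -- Once `op` is pulled out of `R`, the two left sides agree and all terms containing `R(a,a,·,·)`
  -- vanish; the difference is twice the claim.
  simp only [← h.op_comm, h.op_first, h.op_second, map_sub, map_smul,
    LinearMap.sub_apply, LinearMap.smul_apply, smul_eq_mul, e, e', h.op_adj] at h1 h2 ⊢
  linear_combination (h2 - h1) / 2 - (g (op (op a)) a / 2) * h.antisymm' a y c d
    + (g (op a) a / 2) * f

end IsRicciPseudosymmetric
end CurvatureLike

/-! ### Proportional quadratic forms and the relation `op² = t op`. -/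

namespace CurvatureLike

variable {V : Type*} [AddCommGroup V] [Module ℝ V]

/-- A nonzero symmetric bilinear form has a non-isotropic vector. -/
theorem exists_apply_self_ne_zero (q : V →ₗ[ℝ] V →ₗ[ℝ] ℝ) (hq : ∀ a b, q a b = q b a)
    (h : ∃ a b, q a b ≠ 0) : ∃ a, q a a ≠ 0 := by
  by_contra! h0
  obtain ⟨a, b, hab⟩ := h
  have := h0 (a + b)
  simp only [map_add, LinearMap.add_apply, h0, hq b a] at this
  exact hab (by linarith)

/-- Two symmetric bilinear forms that are proportional on each vector are proportional. -/
theorem exists_eq_mul_of_cross (q s : V →ₗ[ℝ] V →ₗ[ℝ] ℝ) (hq : ∀ a b, q a b = q b a)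
    (hs : ∀ a b, s a b = s b a) (hc : ∀ a c, q a a * s a c = s a a * q a c) {e : V}
    (he : q e e ≠ 0) : ∃ t : ℝ, ∀ a b, s a b = t * q a b := by
  set t := s e e / q e e with ht
  have hte : s e e = t * q e e := by rw [ht]; field_simp
  have h1 : ∀ c, s e c = t * q e c := fun c => by
    have := hc e c
    rw [hte] at this
    exact mul_left_cancel₀ he (by linarith)
  have h2 : ∀ b, s b b = t * q b b := fun b => by
    -- These two instances give `(s b b - t * q b b) * (q e e ± q e b) = 0`; adding them eliminates
    -- `q e b`.
    have a1 := hc (e + b) e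
    have a2 := hc (e - b) e
    simp only [map_add, map_sub, LinearMap.add_apply, LinearMap.sub_apply, h1, hs b e, hq b e]
      at a1 a2
    refine mul_left_cancel₀ he ?_
    linear_combination (-a1 - a2) / 2
  refine ⟨t, fun a b => ?_⟩
  have := h2 (a + b)
  simp only [map_add, LinearMap.add_apply, h2, hs b a, hq b a] at this
  linarith

/-- A linear map that vanishes at all non-isotropic vectors of a nonzero symmetric bilinear form
vanishes. -/
theorem eq_zero_of_forall_nonisotropic {W : Type*} [AddCommGroup W] [Module ℝ W]
    (q : V →ₗ[ℝ] V →ₗ[ℝ] ℝ) (hq : ∀ a b, q a b = q b a) (N : V →ₗ[ℝ] W)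
    (hN : ∀ a, q a a ≠ 0 → N a = 0) {e : V} (he : q e e ≠ 0) : N = 0 := by
  ext b
  by_cases hb : q b b = 0
  · by_cases hp : q (e + b) (e + b) = 0
    -- Parallelogram law: with `b` isotropic, `e + b` and `e - b` cannot both be isotropic.
    · have : q (e - b) (e - b) ≠ 0 := by
        intro hm
        simp only [map_add, map_sub, LinearMap.add_apply, LinearMap.sub_apply, hb, hq b e] at hp hm
        exact he (by linarith)
      have := hN _ this
      rw [map_sub, hN e he, zero_sub, neg_eq_zero] at this
      simpa using this
    · have := hN _ hp
      rw [map_add, hN e he, zero_add] at this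
      simpa using this
  · simpa using hN b hb

variable {g : V →ₗ[ℝ] V →ₗ[ℝ] ℝ} {Rm : V →ₗ[ℝ] V →ₗ[ℝ] V →ₗ[ℝ] V} {op : V →ₗ[ℝ] V}

namespace IsRicciPseudosymmetric

variable (h : IsRicciPseudosymmetric g Rm op)
include h

variable [FiniteDimensional ℝ V]

omit [FiniteDimensional ℝ V] in
theorem op_eq_zero_of_annihilates {v : V} (hv : ∀ y c, Rm y v c = 0) : op v = 0 := by
  refine h.nondegenerate _ fun c => ?_
  have : (Rm.flip v).flip c = 0 := by ext y; simpa using hv y c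
  rw [h.ric_eq, ric, this, map_zero]

/-- By `op_first_self`, the vector `S(a,a) op a - S(op a,a) a` annihilates `R`, hence lies in the
kernel of `op`. So the forms `S` and `S(op ·, ·)` are proportional on each vector, with a common
factor `t`; the relation for `R` then holds at vectors with `S(a,a) ≠ 0` and extends by linearity.
-/
theorem exists_factor (h0 : op ≠ 0) : ∃ t : ℝ, (∀ a, op (op a) = t • op a) ∧
    ∀ a b c d, g (Rm (op a) b c) d = t * g (Rm a b c) d := by
  obtain ⟨e, he⟩ : ∃ e, (g ∘ₗ op) e e ≠ 0 := by
    refine exists_apply_self_ne_zero _ (fun a b => h.op_symm a b) ?_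
    by_contra! H
    exact h0 (LinearMap.ext fun a => h.nondegenerate _ fun b => H a b)
  have key : ∀ a y c, Rm y (g (op a) a • op a - g (op (op a)) a • a) c = 0 := fun a y c => by
    refine h.nondegenerate _ fun d => ?_
    simp [h.op_first_self]
  obtain ⟨t, ht⟩ := exists_eq_mul_of_cross (g ∘ₗ op) (g ∘ₗ op ∘ₗ op) (fun a b => h.op_symm a b)
    (fun a b => by simp only [LinearMap.comp_apply]; rw [← h.op_adj, h.symm, h.op_adj])
    (fun a c => by
      have := congrArg (fun z => g z c) (h.op_eq_zero_of_annihilates (key a))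
      simp at this
      simp only [LinearMap.comp_apply]; linarith) he
  simp only [LinearMap.comp_apply] at ht
  refine ⟨t, fun a => h.ext fun b => by simpa using ht a b, fun a b c d => ?_⟩
  have h1 : Rm.flip ∘ₗ (op - t • LinearMap.id) = 0 := by
    refine eq_zero_of_forall_nonisotropic (g ∘ₗ op) (fun a b => h.op_symm a b) _ (fun a ha => ?_) he
    ext y c
    have := key a y c
    rw [ht, mul_comm, mul_smul, ← smul_sub, map_smul, LinearMap.smul_apply, smul_eq_zero] at this
    simpa using this.resolve_left ha
  have h2 := congrArg (fun N => g (N a b c) d) h1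
  simp [sub_eq_zero] at h2
  rw [h.antisymm', h.antisymm' a, h2]; ring

end IsRicciPseudosymmetric
end CurvatureLike

/-! ### A common kernel vector, dimension three, and the formula for `C · C`. -/

namespace CurvatureLike

variable {V : Type*} [AddCommGroup V] [Module ℝ V]

/-- The expansion of `-Q(A, T)(a, b, c, d; x, y)` for a `(0,4)`-tensor `T`. -/
def tach (A : V → V → ℝ) (T : V → V → V → V → ℝ) (x y a b c d : V) : ℝ :=
  (A y a * T x b c d - A x a * T y b c d) + (A y b * T a x c d - A x b * T a y c d)
    + (A y c * T a b x d - A x c * T a b y d) + (A y d * T a b c x - A x d * T a b c y)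

/-- The `(1,3)`-tensor `R - α g ∧ S + (k / 2) g ∧ g`. -/
def weyl (g : V →ₗ[ℝ] V →ₗ[ℝ] ℝ) (Rm : V →ₗ[ℝ] V →ₗ[ℝ] V →ₗ[ℝ] V)
    (op : V →ₗ[ℝ] V) (α k : ℝ) (x y z : V) : V :=
  Rm x y z - α • (g (op y) z • x - g (op x) z • y + g y z • op x - g x z • op y)
    + k • (g y z • x - g x z • y)

variable {g : V →ₗ[ℝ] V →ₗ[ℝ] ℝ} {Rm : V →ₗ[ℝ] V →ₗ[ℝ] V →ₗ[ℝ] V} {op : V →ₗ[ℝ] V}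

theorem weyl_apply (α k : ℝ) (x y z w : V) : g (weyl g Rm op α k x y z) w = g (Rm x y z) w
    - α * (g (op y) z * g x w - g (op x) z * g y w + g y z * g (op x) w - g x z * g (op y) w)
    + k * (g y z * g x w - g x z * g y w) := by
  simp [weyl]

namespace IsRicciPseudosymmetric

variable (h : IsRicciPseudosymmetric g Rm op)
include h

theorem dot_self_eq_tach (x y a b c d : V) :
    g (Rm (Rm x y a) b c) d + g (Rm a (Rm x y b) c) d + g (Rm a b (Rm x y c)) d
      + g (Rm a b c) (Rm x y d) =
    tach (fun x y => g (op x) y) (fun a b c d => g (Rm a b c) d) x y a b c d := by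
  rw [h.dot_self]; simp [tach]

variable [FiniteDimensional ℝ V]

/-- Since `op (op - t) = 0`, take `u` in the image of `op` if `t = 0` and in the image of `t - op`
otherwise. In the second case `z` is chosen non-isotropic for `t g - S`, which makes `g u u`
nonzero. -/
theorem exists_kernel_vector (hS : ¬ ∀ a b, g (op a) b =
      (LinearMap.trace ℝ V op / (finrank ℝ V : ℝ)) * g a b) {t : ℝ}
    (hop : ∀ a, op (op a) = t • op a)
    (hRm : ∀ a b c d, g (Rm (op a) b c) d = t * g (Rm a b c) d) :
    ∃ u, u ≠ 0 ∧ op u = 0 ∧ (∀ b c d, g (Rm u b c) d = 0) ∧ (t ≠ 0 → g u u ≠ 0) ∧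
      (t = 0 → g u u = 0) := by
  by_cases ht : t = 0
  · obtain ⟨z, hz⟩ : ∃ z, op z ≠ 0 := by
      by_contra! H
      have : op = 0 := LinearMap.ext H
      exact hS fun a b => by simp [this]
    exact ⟨op z, hz, by simp [hop, ht], by simp [hRm, ht], fun h => (h ht).elim,
      fun _ => by rw [h.op_adj, hop, ht]; simp⟩
  · obtain ⟨z, hz⟩ := exists_apply_self_ne_zero (g ∘ₗ (t • LinearMap.id - op))
      (fun a b => by simp [h.symm b a, h.op_symm a b]) (by
        by_contra! H
        have e : op = t • LinearMap.id := LinearMap.ext fun a => h.ext fun b => by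
          have := H a b
          simp at this ⊢
          linarith
        refine hS fun a b => ?_
        have hn : (finrank ℝ V : ℝ) ≠ 0 ∨ a = 0 := by
          by_cases hn : finrank ℝ V = 0
          · have := finrank_zero_iff.1 hn
            exact Or.inr (Subsingleton.elim _ _)
          · exact Or.inl (by exact_mod_cast hn)
        rcases hn with hn | rfl
        · rw [e]
          simp
          field_simp
          simp
        · simp)
    have hu : op (t • z - op z) = 0 := by simp [hop]
    have hg : g (t • z - op z) (t • z - op z) = t * g (t • z - op z) z := by
      rw [map_sub, h.op_adj, hu]; simp
    have hne : g (t • z - op z) (t • z - op z) ≠ 0 := by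
      rw [hg]; exact mul_ne_zero ht (by simpa using hz)
    refine ⟨t • z - op z, fun h0 => hne (by rw [h0]; simp), hu, fun b c d => ?_, fun _ => hne,
      fun h => (ht h).elim⟩
    have := hRm (t • z - op z) b c d
    rw [hu] at this
    simp only [map_zero, LinearMap.zero_apply] at this
    exact (mul_eq_zero.1 this.symm).resolve_left ht

/-- `S` and `R` descend to the plane `V/u`, where `R` is a multiple of the square of an area form.
The endomorphism `x ∧_S y` has trace zero there because `S` is symmetric, so it annihilates the area
form. -/
theorem tach_eq_zero_of_finrank_eq_three (hn : finrank ℝ V = 3) {u : V} (hu : u ≠ 0)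
    (hopu : op u = 0) (hRu : ∀ b c d, g (Rm u b c) d = 0) (x y a b c d : V) :
    tach (fun x y => g (op x) y) (fun a b c d => g (Rm a b c) d) x y a b c d = 0 := by
  have hq : finrank ℝ (V ⧸ Submodule.span ℝ {u}) = 2 := by
    have := Submodule.finrank_quotient_add_finrank (Submodule.span ℝ {u})
    rw [finrank_span_singleton hu, hn] at this
    omega
  let e := finBasisOfFinrankEq ℝ _ hq
  obtain ⟨p, hp⟩ := Submodule.mkQ_surjective (Submodule.span ℝ {u}) (e 0)
  obtain ⟨q, hq⟩ := Submodule.mkQ_surjective (Submodule.span ℝ {u}) (e 1)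
  have hdec : ∀ v : V, ∃ r s w : ℝ, v = w • u + r • p + s • q := fun v => by
    have h1 := e.sum_repr ((Submodule.span ℝ {u}).mkQ v)
    rw [Fin.sum_univ_two, ← hp, ← hq, ← map_smul, ← map_smul, ← map_add, eq_comm,
      ← sub_eq_zero, ← map_sub, ← LinearMap.mem_ker, Submodule.ker_mkQ,
      Submodule.mem_span_singleton] at h1
    obtain ⟨w, hw⟩ := h1
    exact ⟨_, _, w, by rw [hw]; abel⟩
  choose f₁ f₂ f₀ hf using hdec
  obtain ⟨A, B, C, hS⟩ : ∃ A B C : ℝ, ∀ a b, g (op a) b = f₁ a * f₁ b * A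
      + (f₁ a * f₂ b + f₂ a * f₁ b) * B + f₂ a * f₂ b * C := by
    refine ⟨g (op p) p, g (op p) q, g (op q) q, fun a b => ?_⟩
    have hu' : ∀ c, g (op c) u = 0 := fun c => by rw [h.op_symm, hopu]; simp
    conv_lhs => rw [hf a, hf b]
    simp [hopu, hu', h.op_symm q p]
    ring
  obtain ⟨ρ, hR⟩ : ∃ ρ : ℝ, ∀ a b c d, g (Rm a b c) d =
      (f₁ a * f₂ b - f₂ a * f₁ b) * (f₁ c * f₂ d - f₂ c * f₁ d) * ρ := by
    refine ⟨g (Rm p q p) q, fun a b c d => ?_⟩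
    have hu2 : ∀ a c d, g (Rm a u c) d = 0 := fun a c d => by rw [h.antisymm', hRu, neg_zero]
    have hu3 : ∀ a b d, g (Rm a b u) d = 0 := fun a c d => by rw [h.pair, hRu]
    have hu4 : ∀ a b d, g (Rm a b d) u = 0 := fun a c d => by rw [h.skew, hu3, neg_zero]
    have h12 : ∀ a c d, g (Rm a a c) d = 0 := fun a c d => by linarith [h.antisymm' a a c d]
    have h34 : ∀ a c d, g (Rm c d a) a = 0 := fun a c d => by linarith [h.skew c d a a]
    have e1 : g (Rm a b c) d = f₁ a * g (Rm p b c) d + f₂ a * g (Rm q b c) d := by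
      conv_lhs => rw [hf a]
      simp [hRu]
    have e2 : ∀ z, g (Rm z b c) d = f₁ b * g (Rm z p c) d + f₂ b * g (Rm z q c) d := fun z => by
      conv_lhs => rw [hf b]
      simp [hu2]
    have e3 : g (Rm p q c) d = f₁ c * g (Rm p q p) d + f₂ c * g (Rm p q q) d := by
      conv_lhs => rw [hf c]
      simp [hu3]
    have e4 : ∀ z, g (Rm p q z) d = f₁ d * g (Rm p q z) p + f₂ d * g (Rm p q z) q := fun z => by
      conv_lhs => rw [hf d]
      simp [hu4]
    rw [e1, e2, e2, h12, h12, h.antisymm' q p, e3, e4, e4, h34, h34, h.skew p q q p]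
    ring
  simp only [tach, hS, hR]
  ring

-- The `g ∧ S` and `g ∧ g` parts of `C` are killed by the action of `R`, because `R · g = 0` and `R
-- · S = 0`; every remaining `op` is absorbed into the factor `t`. No relation between `α`, `k` and
-- the dimension is needed.
set_option maxHeartbeats 2000000 in
theorem weyl_dot_weyl {t : ℝ} (hop : ∀ a, op (op a) = t • op a)
    (hRm : ∀ a b c d, g (Rm (op a) b c) d = t * g (Rm a b c) d) (α k : ℝ) (x y a b c d : V) :
    g (weyl g Rm op α k (weyl g Rm op α k x y a) b c) d
      + g (weyl g Rm op α k a (weyl g Rm op α k x y b) c) d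
      + g (weyl g Rm op α k a b (weyl g Rm op α k x y c)) d
      + g (weyl g Rm op α k a b c) (weyl g Rm op α k x y d) =
    (1 - α) * tach (fun x y => g (op x) y) (fun a b c d => g (Rm a b c) d) x y a b c d
      + (k - α * t) * tach (fun x y => g x y) (fun a b c d => g (weyl g Rm op α k a b c) d)
        x y a b c d := by
  have h2 : ∀ a b c d, g (Rm a (op b) c) d = t * g (Rm a b c) d := fun a b c d => by
    rw [h.op_second, ← h.op_first, hRm]
  have h3 : ∀ a b c d, g (Rm a b (op c)) d = t * g (Rm a b c) d := fun a b c d => by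
    rw [← h.op_first, hRm]
  have h4 : ∀ a b c d, g (Rm a b c) (op d) = t * g (Rm a b c) d := fun a b c d => by
    rw [← h.op_three, h3]
  have hw := h.dot_self_eq_tach x y a b c d
  have hg : ∀ p q, g (Rm x y p) q + g p (Rm x y q) = 0 := fun p q => by
    rw [h.skew, h.symm p]; ring
  have hs := fun p q => h.dot_ric p q x y
  have hop' : ∀ p q, g (op p) (op q) = t * g (op p) q := fun p q => by rw [h.op_adj, hop]; simp
  have hadj : ∀ p q, g p (op q) = g (op p) q := h.op_adj
  simp only [tach, weyl_apply]
  simp only [weyl, map_add, map_sub, map_smul, LinearMap.add_apply, LinearMap.sub_apply,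
    LinearMap.smul_apply, smul_eq_mul, hRm, h2, h3, h4, hop', hadj, hop]
  simp only [h.symm a x, h.symm b x, h.symm a y, h.symm b y, h.op_symm a x, h.op_symm b x,
    h.op_symm a y, h.op_symm b y]
  simp only [tach] at hw
  linear_combination hw - α * (g (op b) c * hg a d + g a d * hs b c - g (op a) c * hg b d
      - g b d * hs a c + g b c * hs a d + g (op a) d * hg b c - g a c * hs b d
      - g (op b) d * hg a c)
    + k * (g b c * hg a d + g a d * hg b c - g a c * hg b d - g b d * hg a c)

end IsRicciPseudosymmetric
end CurvatureLike

/-! ### Vanishing of `Q(S,R)` at a non-Einstein point. -/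

namespace CurvatureLike

variable {V : Type*} [AddCommGroup V] [Module ℝ V]
variable {g : V →ₗ[ℝ] V →ₗ[ℝ] ℝ} {Rm : V →ₗ[ℝ] V →ₗ[ℝ] V →ₗ[ℝ] V} {op : V →ₗ[ℝ] V}

namespace IsRicciPseudosymmetric

variable (h : IsRicciPseudosymmetric g Rm op)
include h

variable [FiniteDimensional ℝ V]

/-- If `(u ∧ Y) · C = 0` for a vector `u` in the nullity of `R`, then `R` is determined by `S` on
the hyperplane orthogonal to `u`. -/
theorem curvature_of_kernel_vector {α k : ℝ} {u : V} (hu : u ≠ 0) (hopu : op u = 0)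
    (hRu : ∀ b c d, g (Rm u b c) d = 0)
    (hQ : ∀ y a b c d, tach (fun x y => g x y) (fun a b c d => g (weyl g Rm op α k a b c) d)
      u y a b c d = 0) (y b c d : V) (hb : g u b = 0) (hc : g u c = 0) (hd : g u d = 0) :
    g (Rm y b c) d = α * (g b c * g (op y) d - g b d * g (op y) c) := by
  obtain ⟨w, hw⟩ : ∃ w, g u w ≠ 0 := by
    by_contra! H
    exact hu (h.nondegenerate u H)
  have hu2 : ∀ a c d, g (Rm a u c) d = 0 := fun a c d => by rw [h.antisymm', hRu, neg_zero]
  have hu3 : ∀ a b d, g (Rm a b u) d = 0 := fun a c d => by rw [h.pair, hRu]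
  have hu4 : ∀ a b d, g (Rm a b d) u = 0 := fun a c d => by rw [h.skew, hu3, neg_zero]
  have hSu : ∀ a, g (op a) u = 0 := fun a => by rw [h.op_symm, hopu]; simp
  -- Orthogonality to `u` leaves only terms with the factor `g u w`; among them the `k` terms and
  -- those with `S(b, ·)` cancel.
  have key := hQ y w b c d
  simp only [tach, weyl_apply, hRu, hu2, hu3, hu4, hSu, hopu, hb, hc, hd, map_zero,
    LinearMap.zero_apply, h.symm b u, h.symm w u] at key
  refine mul_left_cancel₀ hw ?_
  linear_combination (-1 : ℝ) * key

theorem tach_eq_zero_of_kernel_vector {t α k : ℝ} (hα : α ≠ 0)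
    (hRm : ∀ a b c d, g (Rm (op a) b c) d = t * g (Rm a b c) d) (hk : t = 0 → k = 0)
    {u : V} (hu : u ≠ 0) (hopu : op u = 0)
    (hRu : ∀ b c d, g (Rm u b c) d = 0) (hut : t ≠ 0 → g u u ≠ 0) (hut' : t = 0 → g u u = 0)
    (hQ : ∀ y a b c d, tach (fun x y => g x y) (fun a b c d => g (weyl g Rm op α k a b c) d)
      u y a b c d = 0) (x y a b c d : V) :
    tach (fun x y => g (op x) y) (fun a b c d => g (Rm a b c) d) x y a b c d = 0 := by
  have K := h.curvature_of_kernel_vector hu hopu hRu hQ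
  have hu2 : ∀ a c d, g (Rm a u c) d = 0 := fun a c d => by rw [h.antisymm', hRu, neg_zero]
  have hu3 : ∀ a b d, g (Rm a b u) d = 0 := fun a c d => by rw [h.pair, hRu]
  have hu4 : ∀ a b d, g (Rm a b d) u = 0 := fun a c d => by rw [h.skew, hu3, neg_zero]
  have hSu : ∀ a, g (op a) u = 0 := fun a => by rw [h.op_symm, hopu]; simp
  by_cases ht : t = 0
  · obtain ⟨w, hw⟩ : ∃ w, g u w = 1 := by
      obtain ⟨w, hw⟩ : ∃ w, g u w ≠ 0 := by
        by_contra! H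
        exact hu (h.nondegenerate u H)
      exact ⟨(g u w)⁻¹ • w, by simp [hw]⟩
    -- Here `u` is isotropic and `k = 0`; putting `u` in the second slot forces `S` to be a multiple
    -- of the square of the covector `g u`.
    have hf : ∀ y c d, g u d * g (op y) c = g u c * g (op y) d := fun y c d => by
      have key := hQ y w u c d
      simp only [tach, weyl_apply, hRu, hu2, hSu, hopu, hut' ht, hw, hk ht, map_zero,
        LinearMap.zero_apply, h.symm y u, h.symm w u, h.op_symm w] at key
      refine mul_left_cancel₀ hα ?_
      linear_combination (-1 : ℝ) * key
    obtain ⟨ε, hS⟩ : ∃ ε : ℝ, ∀ a b, g (op a) b = ε * g u a * g u b := by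
      refine ⟨g (op w) w, fun a b => ?_⟩
      have h1 := hf a b w
      have h2 := hf w a w
      rw [hw] at h1 h2
      rw [h.op_symm w a] at h2
      linear_combination h1 + g u b * h2
    obtain ⟨σ, hR⟩ : ∃ σ : V → V → ℝ, ∀ a b c d, g (Rm a b c) d =
        g u a * g u c * σ b d - g u a * g u d * σ b c - g u b * g u c * σ a d
          + g u b * g u d * σ a c := by
      refine ⟨fun p q => g (Rm w p w) q, fun a b c d => ?_⟩
      have hw1 : ∀ c d, g (Rm w w c) d = 0 := fun c d => by linarith [h.antisymm' w w c d]
      have hw2 : ∀ c d, g (Rm c d w) w = 0 := fun c d => by linarith [h.skew c d w w]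
      -- As `S` vanishes on the hyperplane orthogonal to `u`, so does `R` in its last three slots;
      -- project along `w` onto that hyperplane and expand.
      have K' : ∀ y b c d, g (Rm y b c) d - g u b * g (Rm y w c) d - g u c * g (Rm y b w) d
          - g u d * g (Rm y b c) w + g u b * g u c * g (Rm y w w) d
          + g u b * g u d * g (Rm y w c) w = 0 := fun y b c d => by
        have := K y (b - g u b • w) (c - g u c • w) (d - g u d • w) (by simp [hw]) (by simp [hw])
          (by simp [hw])
        simp [hS, hw, hw2] at this
        linear_combination this
      have e1 : ∀ y c d, g (Rm w y c) d = g u c * g (Rm w y w) d - g u d * g (Rm w y w) c :=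
        fun y c d => by
          have := K' w y c d
          simp only [hw1] at this
          linear_combination this + g u d * h.skew w y w c
      have P := fun p q => h.pair w p w q
      linear_combination K' a b c d - g u b * e1 a c d + g u b * h.antisymm' a w c d
        + g u c * (h.pair a b w d + e1 d a b) + g u c * g u a * P d b - g u c * g u b * P d a
        + g u d * (h.pair a b c w + h.antisymm' c w a b - e1 c a b)
        - g u d * g u a * P c b + g u d * g u b * P c a
        - g u b * g u c * h.antisymm' a w w d
        - g u b * g u d * (h.antisymm' a w c w - h.skew w a c w)
    simp only [tach, hS, hR]
    ring
  -- The image of `op` is orthogonal to `u`, so `b` may be replaced by `op b`; this turns `g b c`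
  -- into `S(b,c)` and makes `t R` a multiple of `S ∧ S`, for which `Q(S, ·)` vanishes.
  · have hrest : ∀ y b c d, g u b = 0 → g u c = 0 → g u d = 0 →
        t * g (Rm y b c) d = α * (g (op b) c * g (op y) d - g (op b) d * g (op y) c) := by
      intro y b c d _ hc hd
      rw [← hRm, h.op_first, ← h.op_second]
      exact K y (op b) c d (by rw [h.op_adj, hopu]; simp) hc hd
    have hproj : ∀ z, g u (z - (g u z / g u u) • u) = 0 := fun z => by
      have := hut ht
      simp [this]
    have hR : ∀ y b c d, t * g (Rm y b c) d =
        α * (g (op b) c * g (op y) d - g (op b) d * g (op y) c) := fun y b c d => by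
      simpa [hu2, hu3, hu4, hopu, hSu] using hrest y _ _ _ (hproj b) (hproj c) (hproj d)
    refine mul_left_cancel₀ ht ?_
    simp only [tach, mul_add, mul_sub, mul_left_comm t, hR, mul_zero]
    rw [h.op_symm b x, h.op_symm a x, h.op_symm a y, h.op_symm b y]
    ring

/-- A Ricci-semisymmetric curvature tensor with `R · R = Q(S, R)` and `C · C = L Q(g, C)` that is
not Einstein is semisymmetric. -/
theorem semisymmetric_of_weyl_pseudosymmetric (hn : 3 ≤ finrank ℝ V)
    (hS : ¬ ∀ a b, g (op a) b = (LinearMap.trace ℝ V op / (finrank ℝ V : ℝ)) * g a b)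
    {α k : ℝ} (hα : α = 1 / ((finrank ℝ V : ℝ) - 2))
    (hk : k = LinearMap.trace ℝ V op / (((finrank ℝ V : ℝ) - 1) * ((finrank ℝ V : ℝ) - 2)))
    (hC : (∀ a b c d, g (weyl g Rm op α k a b c) d = 0) ∨ ∃ L : ℝ, ∀ x y a b c d,
      g (weyl g Rm op α k (weyl g Rm op α k x y a) b c) d
        + g (weyl g Rm op α k a (weyl g Rm op α k x y b) c) d
        + g (weyl g Rm op α k a b (weyl g Rm op α k x y c)) d
        + g (weyl g Rm op α k a b c) (weyl g Rm op α k x y d) =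
      L * tach (fun x y => g x y) (fun a b c d => g (weyl g Rm op α k a b c) d) x y a b c d)
    (x y a b c d : V) :
    tach (fun x y => g (op x) y) (fun a b c d => g (Rm a b c) d) x y a b c d = 0 := by
  have hop0 : op ≠ 0 := fun h0 => hS fun a b => by simp [h0]
  obtain ⟨t, hop, hRm⟩ := h.exists_factor hop0
  obtain ⟨u, hu, hopu, hRu, hut, hut'⟩ := h.exists_kernel_vector hS hop hRm
  rcases hn.eq_or_lt with hn | hn
  · exact h.tach_eq_zero_of_finrank_eq_three hn.symm hu hopu hRu x y a b c d
  have hn' : (4 : ℝ) ≤ (finrank ℝ V : ℝ) := by exact_mod_cast hn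
  have hα0 : α ≠ 0 := by
    rw [hα]; exact one_div_ne_zero (by linarith)
  have hα1 : 1 - α ≠ 0 := by
    rw [hα, sub_ne_zero, ne_comm, Ne, div_eq_iff (by linarith)]
    intro H; linarith
  -- If `t = 0`, then `op² = 0`, so the scalar curvature is the trace of a nilpotent map.
  have hk0 : t = 0 → k = 0 := fun ht => by
    have hnil : IsNilpotent op := ⟨2, by ext v; simp [pow_two, hop, ht]⟩
    rw [hk, (LinearMap.isNilpotent_trace_of_isNilpotent hnil).eq_zero, zero_div]
  have W := h.weyl_dot_weyl hop hRm α k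
  rcases hC with hC | ⟨L, hL⟩
  · have := W x y a b c d
    simp only [hC, tach, add_zero, mul_zero, sub_self] at this
    rw [eq_comm, mul_eq_zero] at this
    exact this.resolve_left hα1
  · simp only [hL] at W
    by_cases hLk : L = k - α * t
    · have := W x y a b c d
      rw [hLk, right_eq_add, mul_eq_zero] at this
      exact this.resolve_left hα1
    · refine h.tach_eq_zero_of_kernel_vector hα0 hRm hk0 hu hopu hRu hut hut'
        (fun y a b c d => ?_) x y a b c d
      -- Since `u` annihilates both `S` and `R`, it drops out of `Q(S,R)`, leaving a nonzero
      -- multiple of `Q(g,C)`.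
      have h0 : tach (fun x y => g (op x) y) (fun a b c d => g (Rm a b c) d) u y a b c d = 0 := by
        have hu2 : ∀ a c d, g (Rm a u c) d = 0 := fun a c d => by rw [h.antisymm', hRu, neg_zero]
        have hu3 : ∀ a b d, g (Rm a b u) d = 0 := fun a c d => by rw [h.pair, hRu]
        have hu4 : ∀ a b d, g (Rm a b d) u = 0 := fun a c d => by rw [h.skew, hu3, neg_zero]
        simp [tach, hRu, hu2, hu3, hu4, hopu]
      have := W u y a b c d
      rw [h0, mul_zero, zero_add, ← sub_eq_zero, ← sub_mul, mul_eq_zero] at this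
      exact this.resolve_left (sub_ne_zero.2 hLk)

end IsRicciPseudosymmetric
end CurvatureLike

/-! ### Transfer to the tangent spaces of the manifold. -/

namespace CurvatureLike

theorem weyl_wedge {V : Type*} [AddCommGroup V] [Module ℝ V] (g : V →ₗ[ℝ] V →ₗ[ℝ] ℝ)
    (Rm : V →ₗ[ℝ] V →ₗ[ℝ] V →ₗ[ℝ] V) (op : V →ₗ[ℝ] V) (α k : ℝ) (x y a b c d : V) :
    g (weyl g Rm op α k (g y a • x - g x a • y) b c) d
      + g (weyl g Rm op α k a (g y b • x - g x b • y) c) d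
      + g (weyl g Rm op α k a b (g y c • x - g x c • y)) d
      + g (weyl g Rm op α k a b c) (g y d • x - g x d • y) =
    tach (fun x y => g x y) (fun a b c d => g (weyl g Rm op α k a b c) d) x y a b c d := by
  simp only [tach, weyl_apply, map_sub, map_smul, LinearMap.sub_apply, LinearMap.smul_apply,
    smul_eq_mul]
  ring

end CurvatureLike

namespace SemiRiemannianMetric

open TensorAlg CurvatureLike

variable {n : ℕ} {M : Type*} [TopologicalSpace M]
  [ChartedSpace (EuclideanSpace ℝ (Fin n)) M] [IsManifold (𝓡 n) ∞ M]
  (g : SemiRiemannianMetric n M)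

/-- The metric at `x` as a bilinear map. -/
def bilin (x : M) : TangentSpace (𝓡 n) x →ₗ[ℝ] TangentSpace (𝓡 n) x →ₗ[ℝ] ℝ :=
  LinearMap.mk₂ ℝ (fun u v => g.val x u v) (by simp) (by simp) (by simp) (by simp)

/-- The curvature tensor at `x` as a trilinear map. -/
def curvLin (x : M) : TangentSpace (𝓡 n) x →ₗ[ℝ] TangentSpace (𝓡 n) x →ₗ[ℝ]
    TangentSpace (𝓡 n) x →ₗ[ℝ] TangentSpace (𝓡 n) x :=
  LinearMap.mk₂ ℝ (fun u v => (g.curv x u v).toLinearMap)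
    (fun u v w => by ext; simp) (fun u v w => by ext; simp) (fun u v w => by ext; simp)
    (fun u v w => by ext; simp)

@[simp] theorem bilin_apply (x : M) (u v : TangentSpace (𝓡 n) x) :
    g.bilin x u v = g.val x u v := rfl

theorem isCurvatureLike (x : M) : IsCurvatureLike (g.bilin x) (g.curvLin x) := by
  have hs := g.inChart_symm x
  have hG : ContDiffAt ℝ 2 (g.inChart x) (extChartAt (𝓡 n) x x) :=
    (g.contDiffAt_inChart x).of_le (by norm_cast)
  have hp : (g.inChart x (extChartAt (𝓡 n) x x)).IsInvertible := by
    obtain ⟨e, he⟩ := g.val_isInvertible x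
    exact ⟨e, he.trans (g.inChart_self x).symm⟩
  refine ⟨fun a b => g.symm x a b, fun a h => g.nondegenerate x a h,
    fun a b c => ChartMetric.curvature_antisymm (E := EuclideanSpace ℝ (Fin n)) a b c,
    fun a b c => ChartMetric.curvature_bianchi (E := EuclideanSpace ℝ (Fin n)) hs hG hp a b c, fun a b c d => ?_⟩
  have := ChartMetric.curvature_skew (E := EuclideanSpace ℝ (Fin n)) hs hG hp a b c d
  rw [g.inChart_self] at this
  exact this

theorem R_apply (x : M) (a b c d : TangentSpace (𝓡 n) x) :
    g.R x ![a, b, c, d] = g.val x (g.R13 x a b c) d := rfl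

end SemiRiemannianMetric

namespace TensorAlg

theorem dot_four {V : Type*} (D : V → V → V → V) (T : (Fin 4 → V) → ℝ) (a b c d x y : V) :
    dot D T ![a, b, c, d] x y = -(T ![D x y a, b, c, d] + T ![a, D x y b, c, d]
      + T ![a, b, D x y c, d] + T ![a, b, c, D x y d]) := by
  have h0 : Function.update ![a, b, c, d] 0 (D x y a) = ![D x y a, b, c, d] := by
    ext i; fin_cases i <;> rfl
  have h1 : Function.update ![a, b, c, d] 1 (D x y b) = ![a, D x y b, c, d] := by
    ext i; fin_cases i <;> rfl
  have h2 : Function.update ![a, b, c, d] 2 (D x y c) = ![a, b, D x y c, d] := by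
    ext i; fin_cases i <;> rfl
  have h3 : Function.update ![a, b, c, d] 3 (D x y d) = ![a, b, c, D x y d] := by
    ext i; fin_cases i <;> rfl
  simp only [dot, act, Fin.sum_univ_four]
  exact congrArg Neg.neg (by rw [← h0, ← h1, ← h2, ← h3]; rfl)

theorem dot_two {V : Type*} (D : V → V → V → V) (A : V → V → ℝ) (a b x y : V) :
    dot D (two A) ![a, b] x y = -(A (D x y a) b + A a (D x y b)) := by
  simp [dot, act, two]

end TensorAlg

open TensorAlg CurvatureLike

namespace SemiRiemannianMetric

variable {n : ℕ} {M : Type*} [TopologicalSpace M]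
  [ChartedSpace (EuclideanSpace ℝ (Fin n)) M] [IsManifold (𝓡 n) ∞ M]
  (g : SemiRiemannianMetric n M)

theorem isRicciPseudosymmetric (hRS : g.IsRicciSemisymmetric) (x : M)
    (hRR : dot (g.R13 x) (g.R x) = tachibana (g.S x) (g.R x)) :
    IsRicciPseudosymmetric (g.bilin x) (g.curvLin x) (g.ricciOp x) := by
  refine ⟨g.isCurvatureLike x, fun a b => ?_, fun a b p q => ?_, fun p q a b c d => ?_⟩
  · rw [bilin_apply, val_ricciOp]; rfl
  · have := congrFun (congrFun (congrFun (hRS x) ![a, b]) p) q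
    rw [dot_two, ← val_ricciOp, ← val_ricciOp] at this
    simp only [Pi.zero_apply, neg_eq_zero] at this
    exact this
  · have := congrFun (congrFun (congrFun hRR ![a, b, c, d]) p) q
    rw [tachibana, dot_four, dot_four, neg_inj] at this
    simp only [R_apply, wedgeEnd, ← val_ricciOp] at this
    exact this

theorem C13_eq_weyl (x : M) (a b c : TangentSpace (𝓡 n) x) :
    g.C13 x a b c = weyl (g.bilin x) (g.curvLin x) (g.ricciOp x) (1 / ((n : ℝ) - 2))
      (g.scal x / (((n : ℝ) - 1) * ((n : ℝ) - 2))) a b c := by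
  simp only [C13, weyl, ← val_ricciOp]
  rfl

end SemiRiemannianMetric

theorem proposition4p4 (n : ℕ) (hn : 3 ≤ n) (M : Type*) [TopologicalSpace M] [T2Space M]
    [SecondCountableTopology M] [ConnectedSpace M]
    [ChartedSpace (EuclideanSpace ℝ (Fin n)) M] [IsManifold (𝓡 n) ∞ M]
    (g : SemiRiemannianMetric n M)
    (hRS : g.IsRicciSemisymmetric)
    (hRR : ∀ x : M, TensorAlg.dot (g.R13 x) (g.R x) = TensorAlg.tachibana (g.S x) (g.R x))
    (hCC : g.HasPseudosymmetricWeyl) :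
    ∀ x ∈ g.US, TensorAlg.dot (g.R13 x) (g.R x) = 0 := by
  intro x hx
  have h := g.isRicciPseudosymmetric hRS x (hRR x)
  have hdim : Module.finrank ℝ (TangentSpace (𝓡 n) x) = n :=
    (finrank_euclideanSpace_fin : Module.finrank ℝ (EuclideanSpace ℝ (Fin n)) = n)
  have hvec : ∀ v : Fin 4 → TangentSpace (𝓡 n) x, v = ![v 0, v 1, v 2, v 3] := fun v => by
    ext i; fin_cases i <;> rfl
  have key := h.semisymmetric_of_weyl_pseudosymmetric (by rw [hdim]; exact hn)
    (α := 1 / ((n : ℝ) - 2)) (k := g.scal x / (((n : ℝ) - 1) * ((n : ℝ) - 2)))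
    (fun H => hx (by
      funext a b
      have := H a b
      rw [hdim, SemiRiemannianMetric.bilin_apply, SemiRiemannianMetric.bilin_apply,
        SemiRiemannianMetric.val_ricciOp] at this
      exact sub_eq_zero.2 this))
    (by rw [hdim]) (by rw [hdim]; rfl)
    (by
      have hC4 : ∀ a b c d : TangentSpace (𝓡 n) x, g.C x ![a, b, c, d] =
          g.bilin x (weyl (g.bilin x) (g.curvLin x) (g.ricciOp x) (1 / ((n : ℝ) - 2))
            (g.scal x / (((n : ℝ) - 1) * ((n : ℝ) - 2))) a b c) d := fun a b c d => by
        rw [← g.val_C13, g.C13_eq_weyl]; rfl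
      by_cases hC : g.C x = 0
      · left
        intro a b c d
        rw [← hC4, hC]; rfl
      · right
        obtain ⟨L, hL⟩ := hCC
        refine ⟨L x, fun p q a b c d => ?_⟩
        have := congrFun (congrFun (congrFun (hL x hC) ![a, b, c, d]) p) q
        rw [Pi.smul_apply, Pi.smul_apply, Pi.smul_apply, tachibana, dot_four, dot_four, smul_neg,
          neg_inj, smul_eq_mul] at this
        simp only [hC4, g.C13_eq_weyl] at this
        rw [this, ← weyl_wedge]
        rfl)
  funext v p q
  rw [hvec v, dot_four]
  have := h.dot_self_eq_tach p q (v 0) (v 1) (v 2) (v 3)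
  rw [key] at this
  exact neg_eq_zero.2 this

end
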